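/- Let $X$ be a Tychonoff space whose topology contains a coarser second-countable Tychonoff topology (that is, $iw(X)=\aleph_0$), and let $*\in\{1,\mathrm{fin}\}$. Let $C_p(X)$ be the space of continuous functions $X\to\mathbb R$ with the topology of pointwise convergence, and $\mathbf 0$ the zero function. Then the following are equivalent: 1. TWO has a winning strategy in $G_*(\Gamma_F,\Omega)$ on $X$; 2. TWO has a winning strategy in $G_*(\Gamma_{\mathbf 0},\Omega_{\mathbf 0})$ on $C_p(X)$; 3. TWO has a winning strategy in $G_*(\mathcal S,\Omega_{\mathbf 0})$ on $C_p(X)$; 4. TWO has a winning strategy in $G_*(\mathcal S,\mathcal D)$ on $C_p(X)$. The same four statements with "winning strategy" replaced everywhere by "winning Markov strategy" are also equivalent to one another. Here, in round $n\in\omega$ of $G_*(\mathcal A,\mathcal B)$, ONE plays $A_n\in\mathcal A$ and TWO answers with a set $B_n\subseteq A_n$ that is a singleton if $*=1$ and finite if $*=\mathrm{fin}$; TWO wins if $\bigcup_n B_n\in\mathcal B$. A strategy for TWO determines $B_n$ from $(A_0,\dots,A_n)$, a Markov strategy from $(A_n,n)$ only. A cover of $X$ is a family $\mathcal U$ of subsets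 with $\bigcup\mathcal U=X$ and $X\notin\mathcal U$. It is an $\omega$-cover if every finite subset of $X$ lies in a member of $\mathcal U$, and a $\gamma$-cover if it is infinite and each point of $X$ lies in all but finitely many members. $\Omega$ is the family of open $\omega$-covers of $X$. $\Gamma_F$ is the family of $\gamma$-covers $\mathcal U$ of $X$ by cozero sets for which there is a $\gamma$-cover $\{F(U):U\in\mathcal U\}$ by zero sets with $F(U)\subseteq U$ for every $U\in\mathcal U$. $\Omega_{\mathbf 0}$ is the family of sets $A\subseteq C_p(X)$ with $\mathbf 0\in\overline A$. $\Gamma_{\mathbf 0}$ consists of $\{\mathbf 0\}$ and of all infinite $A\subseteq C_p(X)$ with $\mathbf 0\notin A$ and $A\setminus U$ finite for every neighbourhood $U$ of $\mathbf 0$. $\mathcal D$ is the family of dense subsets of $C_p(X)$, and $\mathcal S$ the family of sequentially dense ones, i.e. those $A$ such that every point of $C_p(X)$ is the limit of a sequence of points of $A$. -/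

import Mathlib

open Set Filter Topology

namespace CpGames

/-! ### Selection games -/

/-- The parameter `∗ ∈ {1, fin}` of a selection game. -/
inductive Kind where
  | one
  | fin

/-- The legal answers of TWO to the move `A` of ONE. In the game `G₁` TWO picks a point `b ∈ A`,
recorded as the singleton `{b}`; in the game `G_fin` TWO picks a finite subset of `A`. -/
def legalMoves {α : Type*} (k : Kind) (A : Set α) : Set (Set α) :=
  match k with
  | .one => {B | ∃ b ∈ A, B = {b}}
  | .fin => {B | B.Finite ∧ B ⊆ A}

/-- `TWO ↑ G_k(𝒜, ℬ)`: TWO has a winning strategy. Here `σ n ⟨A₀, …, Aₙ⟩` is the answer of TWO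
in round `n` after ONE has played `A₀, …, Aₙ`. -/
def TwoWins {α : Type*} (k : Kind) (𝒜 ℬ : Set (Set α)) : Prop :=
  ∃ σ : (n : ℕ) → (Fin (n + 1) → Set α) → Set α,
    (∀ (n : ℕ) (A : Fin (n + 1) → Set α), (∀ i, A i ∈ 𝒜) →
      σ n A ∈ legalMoves k (A (Fin.last n))) ∧
    ∀ A : ℕ → Set α, (∀ n, A n ∈ 𝒜) → (⋃ n, σ n (fun i : Fin (n + 1) => A i)) ∈ ℬ

/-- TWO has a winning Markov strategy in `G_k(𝒜, ℬ)`: the answer depends only on the most recent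
move of ONE and on the number of the round. -/
def TwoWinsMarkov {α : Type*} (k : Kind) (𝒜 ℬ : Set (Set α)) : Prop :=
  ∃ σ : Set α → ℕ → Set α,
    (∀ A ∈ 𝒜, ∀ n, σ A n ∈ legalMoves k A) ∧
    ∀ A : ℕ → Set α, (∀ n, A n ∈ 𝒜) → (⋃ n, σ (A n) n) ∈ ℬ

/-! ### Covers -/

/-- A (nontrivial) cover of `X`. -/
def IsCover {X : Type*} (𝒰 : Set (Set X)) : Prop :=
  ⋃₀ 𝒰 = univ ∧ univ ∉ 𝒰

/-- An `ω`-cover: every finite subset is contained in a member. -/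
def IsOmegaCover {X : Type*} (𝒰 : Set (Set X)) : Prop :=
  IsCover 𝒰 ∧ ∀ F : Set X, F.Finite → ∃ U ∈ 𝒰, F ⊆ U

/-- A `γ`-cover: infinite, and each point is in all but finitely many members. -/
def IsGammaCover {X : Type*} (𝒰 : Set (Set X)) : Prop :=
  IsCover 𝒰 ∧ 𝒰.Infinite ∧ ∀ x : X, {U ∈ 𝒰 | x ∉ U}.Finite

/-- `Ω`: the family of all open `ω`-covers of `X`. -/
def Omega (X : Type*) [TopologicalSpace X] : Set (Set (Set X)) :=
  {𝒰 | (∀ U ∈ 𝒰, IsOpen U) ∧ IsOmegaCover 𝒰}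

/-- The zero set of a continuous real-valued function. -/
def IsZeroSet {X : Type*} [TopologicalSpace X] (Z : Set X) : Prop :=
  ∃ f : X → ℝ, Continuous f ∧ Z = f ⁻¹' {0}

/-- A cozero set is the complement of a zero set. -/
def IsCozeroSet {X : Type*} [TopologicalSpace X] (U : Set X) : Prop :=
  IsZeroSet Uᶜ

/-- `Γ_F`: the family of all `γ_F`-shrinkable `γ`-covers of `X` by cozero sets, that is, those
`𝒰` for which there is a `γ`-cover `{F(U) : U ∈ 𝒰}` by zero sets with `F(U) ⊆ U` for all
`U ∈ 𝒰`. -/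
def GammaF (X : Type*) [TopologicalSpace X] : Set (Set (Set X)) :=
  {𝒰 | (∀ U ∈ 𝒰, IsCozeroSet U) ∧ IsGammaCover 𝒰 ∧
    ∃ F : Set X → Set X, (∀ U ∈ 𝒰, IsZeroSet (F U) ∧ F U ⊆ U) ∧ IsGammaCover (F '' 𝒰)}

/-! ### Dense sets and local families -/

/-- `Ω_x`: the sets having `x` in their closure. -/
def OmegaAt {Y : Type*} [TopologicalSpace Y] (x : Y) : Set (Set Y) :=
  {A | x ∈ closure A}

/-- `Γ_x`: the sets converging to `x`, i.e. the infinite sets `A ∌ x` such that `A \ U` is finite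
for every neighbourhood `U` of `x`, together with the set `{x}`. -/
def GammaAt {Y : Type*} [TopologicalSpace Y] (x : Y) : Set (Set Y) :=
  {A | (A.Infinite ∧ x ∉ A ∧ ∀ U ∈ 𝓝 x, (A \ U).Finite) ∨ A = {x}}

/-- `𝒟`: the family of all dense subsets. -/
def DenseSets (Y : Type*) [TopologicalSpace Y] : Set (Set Y) :=
  {A | Dense A}

/-- `𝒮`: the family of all sequentially dense subsets (every point of the space is the limit of
a sequence of points of the set). -/
def SeqDenseSets (Y : Type*) [TopologicalSpace Y] : Set (Set Y) :=
  {A | seqClosure A = univ}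

/-! ### The space `C_p(X)` -/

/-- `C_p(X)`: the continuous real-valued functions on `X` with the topology of pointwise
convergence, i.e. the subspace topology inherited from the product `X → ℝ`. -/
abbrev Cp (X : Type*) [TopologicalSpace X] : Type _ :=
  {f : X → ℝ // Continuous f}

/-- The constant function `𝟎` as a point of `C_p(X)`. -/
def Cp.zero (X : Type*) [TopologicalSpace X] : Cp X :=
  ⟨fun _ => 0, continuous_const⟩

/-- `X` has a coarser second-countable Tychonoff topology, i.e. `iw(X) = ℵ₀`. (In Mathlib's order
on topologies, `s ≤ t` means that `t` is coarser than `s`.) -/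
def HasCoarserSecondCountable (X : Type*) [s : TopologicalSpace X] : Prop :=
  ∃ t : TopologicalSpace X, s ≤ t ∧ @T35Space X t ∧ @SecondCountableTopology X t

end CpGames

namespace CpGames

open TopologicalSpace

/-! ### Legal moves and reductions between games -/

section Games

variable {α β : Type*} {k : Kind} {𝒜 ℬ : Set (Set α)} {𝒜' ℬ' : Set (Set β)}

/-! The cycle 1 → 2 → 3 → 1 is a chain of round-by-round translations. Each uses only the current
move and the round number, so `GameReduction` transfers ordinary and Markov strategies alike. 1 → 2:
in round n a set A converging to 0 becomes the cover by the sets where |f| < 2⁻ⁿ, f ∈ A. This fails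
only if some f ∈ A is uniformly below 2⁻ⁿ, and then TWO takes f. An ω-cover stays one, as far as
finite sets go, after finitely many members are dropped; so late rounds bring answers close to 0. 2
→ 3: a sequentially dense set contains a set from Γ₀. 3 → 1: shrinkability makes the functions equal
to 1 off a member of the cover sequentially dense, and such an f with |f| < 1 on F forces F into
that member. 3 → 4: the coarser topology makes C_p(X) separable; TWO plays the translated games at
all points of a dense sequence at once (`forall_nat`). 4 → 3 is immediate. -/

theorem finite_of_mem_legalMoves {A B : Set α} (h : B ∈ legalMoves k A) : B.Finite := by
  cases k with
  | one => obtain ⟨b, -, rfl⟩ := h; exact finite_singleton b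
  | fin => exact h.1

theorem subset_of_mem_legalMoves {A B : Set α} (h : B ∈ legalMoves k A) : B ⊆ A := by
  cases k with
  | one => obtain ⟨b, hb, rfl⟩ := h; exact singleton_subset_iff.2 hb
  | fin => exact h.2

theorem singleton_mem_legalMoves {A : Set α} {a : α} (h : a ∈ A) : {a} ∈ legalMoves k A := by
  cases k with
  | one => exact ⟨a, h, rfl⟩
  | fin => exact ⟨finite_singleton a, singleton_subset_iff.2 h⟩

theorem image_mem_legalMoves {A B : Set α} {A' : Set β} {g : α → β} (hg : MapsTo g A A')
    (h : B ∈ legalMoves k A) : g '' B ∈ legalMoves k A' := by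
  cases k with
  | one => obtain ⟨b, hb, rfl⟩ := h; exact ⟨g b, hg hb, image_singleton⟩
  | fin => exact ⟨h.1.image g, (image_mono h.2).trans hg.image_subset⟩

theorem legalMoves_mono {A A' B : Set α} (hA : A ⊆ A') (h : B ∈ legalMoves k A) :
    B ∈ legalMoves k A' := by
  simpa using image_mem_legalMoves (g := id) hA h

/-- A translation of moves, round by round, from the game `G_k(𝒜', ℬ')` to `G_k(𝒜, ℬ)`, with a
translation of the answers of TWO in the opposite direction. -/
structure GameReduction (k : Kind) (𝒜 ℬ : Set (Set α)) (𝒜' ℬ' : Set (Set β)) where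
  move : ℕ → Set β → Set α
  answer : ℕ → Set β → Set α → Set β
  move_mem : ∀ n, ∀ A ∈ 𝒜', move n A ∈ 𝒜
  answer_mem : ∀ n, ∀ A ∈ 𝒜', ∀ B ∈ legalMoves k (move n A), answer n A B ∈ legalMoves k A
  wins : ∀ (A : ℕ → Set β) (B : ℕ → Set α), (∀ n, A n ∈ 𝒜') →
    (∀ n, B n ∈ legalMoves k (move n (A n))) → (⋃ n, B n) ∈ ℬ →
    (⋃ n, answer n (A n) (B n)) ∈ ℬ'

theorem GameReduction.twoWins (r : GameReduction k 𝒜 ℬ 𝒜' ℬ') (h : TwoWins k 𝒜 ℬ) :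
    TwoWins k 𝒜' ℬ' := by
  obtain ⟨σ, hσ, hw⟩ := h
  refine ⟨fun n A => r.answer n (A (Fin.last n)) (σ n fun i => r.move i (A i)), ?_, ?_⟩
  · intro n A hA
    exact r.answer_mem n _ (hA _) _ (hσ n (fun i => r.move i (A i)) fun i => r.move_mem _ _ (hA i))
  · intro A hA
    exact r.wins A (fun n => σ n fun i => r.move i (A i)) hA
      (fun n => hσ n (fun i => r.move i (A i)) fun i => r.move_mem _ _ (hA i))
      (hw (fun n => r.move n (A n)) fun n => r.move_mem _ _ (hA n))

theorem GameReduction.twoWinsMarkov (r : GameReduction k 𝒜 ℬ 𝒜' ℬ')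
    (h : TwoWinsMarkov k 𝒜 ℬ) : TwoWinsMarkov k 𝒜' ℬ' := by
  obtain ⟨σ, hσ, hw⟩ := h
  refine ⟨fun A n => r.answer n A (σ (r.move n A) n), ?_, ?_⟩
  · intro A hA n
    exact r.answer_mem n _ hA _ (hσ _ (r.move_mem _ _ hA) n)
  · intro A hA
    exact r.wins A (fun n => σ (r.move n (A n)) n) hA
      (fun n => hσ _ (r.move_mem _ _ (hA n)) n)
      (hw (fun n => r.move n (A n)) fun n => r.move_mem _ _ (hA n))

theorem TwoWinsMarkov.twoWins (h : TwoWinsMarkov k 𝒜 ℬ) : TwoWins k 𝒜 ℬ := by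
  obtain ⟨σ, hσ, hw⟩ := h
  exact ⟨fun n A => σ (A (Fin.last n)) n, fun n A hA => hσ _ (hA _) n, hw⟩

theorem TwoWins.mono {ℬ₂ : Set (Set α)} (hℬ : ℬ ⊆ ℬ₂) (h : TwoWins k 𝒜 ℬ) :
    TwoWins k 𝒜 ℬ₂ := by
  obtain ⟨σ, hσ, hw⟩ := h
  exact ⟨σ, hσ, fun A hA => hℬ (hw A hA)⟩

theorem TwoWinsMarkov.mono {ℬ₂ : Set (Set α)} (hℬ : ℬ ⊆ ℬ₂) (h : TwoWinsMarkov k 𝒜 ℬ) :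
    TwoWinsMarkov k 𝒜 ℬ₂ := by
  obtain ⟨σ, hσ, hw⟩ := h
  exact ⟨σ, hσ, fun A hA => hℬ (hw A hA)⟩

/-- TWO can win countably many games against the same moves of ONE simultaneously, by splitting the
rounds into infinitely many infinite sets. -/
theorem TwoWins.forall_nat {ℬ : ℕ → Set (Set α)} (h : ∀ j, TwoWins k 𝒜 (ℬ j)) :
    TwoWins k 𝒜 {C | ∀ j, ∃ B ∈ ℬ j, B ⊆ C} := by
  choose σ hσ hw using h
  -- Round `Nat.pair j m` is round m of game j. Pairing increases in its second argument, so the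
  -- earlier rounds of game j have already been played.
  have hle (n : ℕ) (i : Fin (n.unpair.2 + 1)) : Nat.pair n.unpair.1 i < n + 1 := by
    rw [Nat.lt_succ_iff]
    conv_rhs => rw [← Nat.pair_unpair n]
    rcases (Nat.lt_succ_iff.1 i.2).eq_or_lt with h | h
    · rw [h]
    · exact (Nat.pair_lt_pair_right _ h).le
  refine ⟨fun n A => σ n.unpair.1 n.unpair.2 fun i => A ⟨Nat.pair n.unpair.1 i, hle n i⟩, ?_, ?_⟩
  · intro n A hA
    have h1 := hσ n.unpair.1 n.unpair.2
      (fun i => A ⟨Nat.pair n.unpair.1 i, hle n i⟩) fun i => hA _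
    have h2 : (⟨Nat.pair n.unpair.1 (Fin.last n.unpair.2 : Fin (n.unpair.2 + 1)),
        hle n (Fin.last _)⟩ : Fin (n + 1)) = Fin.last n := by
      ext
      simp
    simpa only [h2] using h1
  · intro A hA j
    refine ⟨_, hw j (fun m => A (Nat.pair j m)) fun m => hA _, ?_⟩
    refine iUnion_subset fun m => ?_
    -- The type of the history depends on m, so the unpairing equations are applied through free
    -- variables.
    have hm : ∀ a b, a = j → b = m → (σ j m fun i : Fin (m + 1) => A (Nat.pair j i)) =
        σ a b fun i : Fin (b + 1) => A (Nat.pair a i) := by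
      rintro a b rfl rfl; rfl
    rw [hm (Nat.pair j m).unpair.1 (Nat.pair j m).unpair.2 (by simp) (by simp)]
    exact subset_iUnion (fun n : ℕ => σ n.unpair.1 n.unpair.2
      fun i : Fin (n.unpair.2 + 1) => A (Nat.pair n.unpair.1 i)) (Nat.pair j m)

theorem TwoWinsMarkov.forall_nat {ℬ : ℕ → Set (Set α)} (h : ∀ j, TwoWinsMarkov k 𝒜 (ℬ j)) :
    TwoWinsMarkov k 𝒜 {C | ∀ j, ∃ B ∈ ℬ j, B ⊆ C} := by
  choose σ hσ hw using h
  refine ⟨fun A n => σ n.unpair.1 A n.unpair.2, fun A hA n => hσ _ A hA _, fun A hA j => ?_⟩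
  refine ⟨_, hw j (fun m => A (Nat.pair j m)) fun m => hA _, iUnion_subset fun m => ?_⟩
  simpa using subset_iUnion (fun n : ℕ => σ n.unpair.1 (A n) n.unpair.2) (Nat.pair j m)

end Games

/-! ### Covers -/

section Covers

variable {X ι : Type*}

/-- The image is infinite: a value taken infinitely often would contain every point, but no `V i` is
everything. -/
theorem isGammaCover_image {A : Set ι} {V : ι → Set X} (hA : A.Infinite)
    (hV : ∀ i ∈ A, V i ≠ univ) (hfin : ∀ x, {i ∈ A | x ∉ V i}.Finite) :
    IsGammaCover (V '' A) := by
  refine ⟨⟨?_, ?_⟩, ?_, ?_⟩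
  · refine eq_univ_of_forall fun x => ?_
    obtain ⟨i, hi, hx⟩ := (hA.sdiff (hfin x)).nonempty
    exact ⟨V i, mem_image_of_mem V hi, by_contra fun h => hx ⟨hi, h⟩⟩
  · rintro ⟨i, hi, h⟩
    exact hV i hi h
  · intro hf
    obtain ⟨U, -, hU⟩ : ∃ U ∈ V '' A, {i ∈ A | V i = U}.Infinite := by
      by_contra! h
      refine hA ((hf.biUnion h).subset fun i hi => ?_)
      exact mem_biUnion (mem_image_of_mem V hi) ⟨hi, rfl⟩
    obtain ⟨i₀, hi₀, h₀⟩ := hU.nonempty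
    refine hV i₀ hi₀ (eq_univ_of_forall fun x => ?_)
    obtain ⟨i, hi, hx⟩ := (hU.sdiff (hfin x)).nonempty
    rw [h₀, ← hi.2]
    exact by_contra fun h => hx ⟨hi.1, h⟩
  · intro x
    refine ((hfin x).image V).subset ?_
    rintro _ ⟨⟨i, hi, rfl⟩, hx⟩
    exact ⟨i, ⟨hi, hx⟩, rfl⟩

/-- Enlarge F by a point outside each proper subset in 𝒱; a member containing the enlarged set
avoids 𝒱. -/
theorem IsOmegaCover.exists_notMem {𝒰 𝒱 : Set (Set X)} (h : IsOmegaCover 𝒰) (h𝒱 : 𝒱.Finite)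
    {F : Set X} (hF : F.Finite) : ∃ U ∈ 𝒰, U ∉ 𝒱 ∧ F ⊆ U := by
  have hex (V : Set X) : ∃ P : Set X, P.Finite ∧ (V ≠ univ → ¬ P ⊆ V) := by
    by_cases hV : V = univ
    · exact ⟨∅, finite_empty, fun h => absurd hV h⟩
    · obtain ⟨x, hx⟩ := (ne_univ_iff_exists_notMem V).1 hV
      exact ⟨{x}, finite_singleton x, fun _ h => hx (h rfl)⟩
  choose P hPfin hP using hex
  obtain ⟨U, hU, hFU⟩ := h.2 (F ∪ ⋃ V ∈ 𝒱, P V) (hF.union (h𝒱.biUnion fun V _ => hPfin V))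
  refine ⟨U, hU, fun hUV => ?_, subset_union_left.trans hFU⟩
  exact hP U (fun h' => h.1.2 (h' ▸ hU))
    ((subset_biUnion_of_mem (u := P) hUV).trans (subset_union_right.trans hFU))

theorem IsCozeroSet.isOpen [TopologicalSpace X] {U : Set X} (h : IsCozeroSet U) : IsOpen U := by
  obtain ⟨f, hf, hU⟩ := h
  rw [← isClosed_compl_iff, hU]
  exact isClosed_singleton.preimage hf

theorem isCozeroSet_abs_lt [TopologicalSpace X] {f : X → ℝ} (hf : Continuous f) (r : ℝ) :
    IsCozeroSet {x | |f x| < r} := by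
  refine ⟨fun x => max (r - |f x|) 0, by fun_prop, ?_⟩
  ext x
  simp

theorem isZeroSet_abs_le [TopologicalSpace X] {f : X → ℝ} (hf : Continuous f) (r : ℝ) :
    IsZeroSet {x | |f x| ≤ r} := by
  refine ⟨fun x => max (|f x| - r) 0, by fun_prop, ?_⟩
  ext x
  simp

/-- A zero set inside a cozero set is functionally separated from the complement. -/
theorem exists_continuous_zero_one [TopologicalSpace X] {Z U : Set X} (hZ : IsZeroSet Z)
    (hU : IsCozeroSet U) (h : Z ⊆ U) :
    ∃ f : X → ℝ, Continuous f ∧ (∀ x ∈ Z, f x = 0) ∧ ∀ x ∉ U, f x = 1 := by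
  obtain ⟨a, ha, rfl⟩ := hZ
  obtain ⟨b, hb, hbU⟩ := hU
  have hb0 (x : X) : x ∉ U ↔ b x = 0 := by
    rw [← mem_compl_iff, hbU]; rfl
  have hne (x : X) (hx : b x = 0) : a x ≠ 0 := fun hax => (hb0 x).2 hx (h hax)
  have hpos (x : X) : |a x| + |b x| ≠ 0 := by
    intro h0
    have h1 := abs_nonneg (a x)
    have h2 := abs_nonneg (b x)
    exact hne x (abs_eq_zero.1 (by linarith)) (abs_eq_zero.1 (by linarith))
  refine ⟨fun x => |a x| / (|a x| + |b x|), by fun_prop (disch := exact hpos _), ?_, ?_⟩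
  · intro x hx
    have : a x = 0 := hx
    simp [this]
  · intro x hx
    have h0 := (hb0 x).1 hx
    simp [h0, hne x h0]

end Covers

/-! ### The space `C_p(X)` -/

section Cp

variable {X : Type*} [TopologicalSpace X]

instance Cp.instNonempty : Nonempty (Cp X) :=
  ⟨Cp.zero X⟩

theorem Cp.mem_closure_iff {A : Set (Cp X)} {g : Cp X} :
    g ∈ closure A ↔ ∀ F : Set X, F.Finite → ∀ ε > 0, ∃ f ∈ A, ∀ x ∈ F, |f.1 x - g.1 x| < ε := by
  rw [mem_closure_iff_nhds]
  constructor
  · intro h F hF ε hε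
    have hU : {f : Cp X | ∀ x ∈ F, |f.1 x - g.1 x| < ε} ∈ 𝓝 g := by
      refine (Filter.eventually_all_finite hF).2 fun x _ => ?_
      have hc : Continuous fun f : Cp X => |f.1 x - g.1 x| :=
        (((continuous_apply x).comp continuous_subtype_val).sub continuous_const).abs
      exact hc.continuousAt.eventually_lt continuousAt_const (by simpa using hε)
    obtain ⟨f, hf, hfA⟩ := h _ hU
    exact ⟨f, hfA, hf⟩
  · intro h U hU
    obtain ⟨V, hV, hVU⟩ := mem_nhds_subtype _ _ _ |>.1 hU
    rw [nhds_pi, Filter.mem_pi] at hV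
    obtain ⟨I, hI, t, ht, htV⟩ := hV
    have hε : ∀ᶠ ε in 𝓝[>] (0 : ℝ), ∀ x ∈ I, Metric.ball (g.1 x) ε ⊆ t x := by
      refine (Filter.eventually_all_finite hI).2 fun x _ => ?_
      obtain ⟨δ, hδ, hb⟩ := Metric.mem_nhds_iff.1 (ht x)
      filter_upwards [Ioo_mem_nhdsGT hδ] with ε hε
      exact (Metric.ball_subset_ball hε.2.le).trans hb
    obtain ⟨ε, hb, hε⟩ := (hε.and self_mem_nhdsWithin).exists
    obtain ⟨f, hfA, hf⟩ := h I hI ε hε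
    exact ⟨f, hVU (htV fun x hx => hb x hx (by simpa [Real.dist_eq] using hf x hx)), hfA⟩

theorem zero_mem_closure_iff {A : Set (Cp X)} :
    Cp.zero X ∈ closure A ↔ ∀ F : Set X, F.Finite → ∀ ε > 0, ∃ f ∈ A, ∀ x ∈ F, |f.1 x| < ε := by
  simp [Cp.mem_closure_iff, Cp.zero]

theorem Cp.tendsto_iff {u : ℕ → Cp X} {g : Cp X} :
    Tendsto u atTop (𝓝 g) ↔ ∀ x, Tendsto (fun n => (u n).1 x) atTop (𝓝 (g.1 x)) := by
  rw [tendsto_subtype_rng, tendsto_pi_nhds]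

/-- Translation by `g` on `C_p(X)`. -/
def Cp.translate (g f : Cp X) : Cp X :=
  ⟨fun x => f.1 x + g.1 x, f.2.add g.2⟩

theorem Cp.continuous_translate (g : Cp X) : Continuous (Cp.translate g) :=
  Continuous.subtype_mk (continuous_pi fun x =>
    ((continuous_apply x).comp continuous_subtype_val).add continuous_const) _

theorem Cp.translate_zero (g : Cp X) : Cp.translate g (Cp.zero X) = g :=
  Subtype.ext (funext fun x => zero_add (g.1 x))

theorem preimage_translate_mem_seqDenseSets (g : Cp X) {S : Set (Cp X)}
    (hS : S ∈ SeqDenseSets (Cp X)) : Cp.translate g ⁻¹' S ∈ SeqDenseSets (Cp X) := by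
  refine eq_univ_of_forall fun f => ?_
  obtain ⟨u, huS, hu⟩ : Cp.translate g f ∈ seqClosure S := by
    rw [show seqClosure S = univ from hS]; trivial
  refine ⟨fun n => ⟨fun x => (u n).1 x - g.1 x, (u n).2.sub g.2⟩, fun n => ?_, ?_⟩
  · rw [mem_preimage]
    convert huS n using 1
    exact Subtype.ext (funext fun x => sub_add_cancel ((u n).1 x) (g.1 x))
  · rw [Cp.tendsto_iff] at hu ⊢
    intro x
    simpa [Cp.translate] using (hu x).sub_const (g.1 x)

theorem finite_setOf_le_abs {A : Set (Cp X)}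
    (hA : ∀ U ∈ 𝓝 (Cp.zero X), (A \ U).Finite) (x : X) {r : ℝ} (hr : 0 < r) :
    {f ∈ A | r ≤ |f.1 x|}.Finite := by
  have hc : Continuous fun f : Cp X => |f.1 x| :=
    ((continuous_apply x).comp continuous_subtype_val).abs
  have hU : {f : Cp X | |f.1 x| < r} ∈ 𝓝 (Cp.zero X) :=
    hc.continuousAt.eventually_lt continuousAt_const (by simpa [Cp.zero] using hr)
  refine (hA _ hU).subset fun f hf => ⟨hf.1, ?_⟩
  simpa using hf.2

theorem exists_continuous_injective_hilbertCube (Y : Type*) [TopologicalSpace Y] [T3Space Y]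
    [SecondCountableTopology Y] :
    ∃ e : Y → ℕ → unitInterval, Continuous e ∧ Function.Injective e := by
  obtain ⟨f, hf⟩ := exists_embedding_l_infty Y
  refine ⟨fun y n => unitInterval.sigmoid (f y n), continuous_pi fun n => ?_, fun x y hxy => ?_⟩
  · exact unitInterval.continuous_sigmoid.comp
      ((continuous_eval_const n).comp hf.continuous)
  · refine hf.injective (BoundedContinuousFunction.ext fun n => ?_)
    exact unitInterval.sigmoid_strictMono.injective (congrFun hxy n)

/-- If `X` has a coarser second-countable Tychonoff topology, then `C_p(X)` is separable. -/
theorem separableSpace_cp (hX : HasCoarserSecondCountable X) :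
    SeparableSpace (Cp X) := by
  obtain ⟨e, he, hinj⟩ : ∃ e : X → ℕ → unitInterval, Continuous e ∧ Function.Injective e := by
    obtain ⟨t, hst, h35, h2⟩ := hX
    obtain ⟨e, het, hinj⟩ := @exists_continuous_injective_hilbertCube X t
      (@T35Space.instT3space X t h35) h2
    exact ⟨e, continuous_le_dom (t₁ := t) hst het, hinj⟩
  let R : C(ℕ → unitInterval, ℝ) → Cp X := fun h => ⟨h ∘ e, h.continuous.comp he⟩
  have hR : Continuous R :=
    Continuous.subtype_mk (continuous_pi fun x => continuous_eval_const (e x)) _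
  refine DenseRange.separableSpace (f := R) (fun g => Cp.mem_closure_iff.2 ?_) hR
  intro F hF ε hε
  have hF' : (e '' F).Finite := hF.image e
  have : Finite (e '' F) := hF'
  -- Tietze: the values of g, carried to the finite set `e '' F` by injectivity of e, extend to the
  -- cube.
  obtain ⟨h, hh⟩ := ContinuousMap.exists_restrict_eq hF'.isClosed
    (⟨fun y => Function.extend e g.1 0 y.1, continuous_of_discreteTopology⟩ : C(e '' F, ℝ))
  refine ⟨R h, mem_range_self h, fun x hx => ?_⟩
  have hval := DFunLike.congr_fun hh ⟨e x, mem_image_of_mem e hx⟩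
  simp only [ContinuousMap.restrict_apply, ContinuousMap.coe_mk, hinj.extend_apply] at hval
  simpa [R, hval] using hε

end Cp

/-! ### From covers to convergent sets -/

section Reductions

variable {X : Type*} [TopologicalSpace X] {k : Kind}

/-- The set where `f` is smaller than `2⁻ⁿ` in absolute value. -/
def smallSet (n : ℕ) (f : Cp X) : Set X :=
  {x | |f.1 x| < (1 / 2) ^ n}

/-- `A` has a member that is uniformly smaller than `2⁻ⁿ`. -/
def HasSmallMember (n : ℕ) (A : Set (Cp X)) : Prop :=
  ∃ f ∈ A, smallSet n f = univ

theorem gammaAt_cases {n : ℕ} {A : Set (Cp X)} (hA : A ∈ GammaAt (Cp.zero X))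
    (hn : ¬ HasSmallMember n A) : A.Infinite ∧ ∀ U ∈ 𝓝 (Cp.zero X), (A \ U).Finite := by
  rcases hA with h | rfl
  · exact ⟨h.1, h.2.2⟩
  · exact absurd ⟨Cp.zero X, rfl, eq_univ_of_forall fun x => by simp [smallSet, Cp.zero]⟩ hn

/-- The closed condition |f| ≤ 2⁻⁽ⁿ⁺¹⁾ supplies the shrinking. -/
theorem image_smallSet_mem_gammaF {n : ℕ} {A : Set (Cp X)} (hA : A ∈ GammaAt (Cp.zero X))
    (hn : ¬ HasSmallMember n A) : smallSet n '' A ∈ GammaF X := by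
  obtain ⟨hinf, hconv⟩ := gammaAt_cases hA hn
  have hne : ∀ f ∈ A, smallSet n f ≠ univ := fun f hf h => hn ⟨f, hf, h⟩
  have hγ : IsGammaCover (smallSet n '' A) :=
    isGammaCover_image hinf hne fun x => by
      simpa [smallSet] using finite_setOf_le_abs hconv x (r := (1 / 2) ^ n) (by positivity)
  -- Different functions may give the same set, so one representative is fixed for each member.
  let s : Set X → Cp X := Function.invFunOn (smallSet n) A
  have hsA : ∀ U ∈ smallSet n '' A, s U ∈ A := fun U hU => Function.invFunOn_mem hU
  have hsU : ∀ U ∈ smallSet n '' A, smallSet n (s U) = U := fun U hU => Function.invFunOn_eq hU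
  have hsub : ∀ U ∈ smallSet n '' A, {x | |(s U).1 x| ≤ (1 / 2) ^ (n + 1)} ⊆ U := by
    intro U hU x hx
    rw [← hsU U hU]
    have hx' : |(s U).1 x| ≤ (1 / 2) ^ (n + 1) := hx
    refine lt_of_le_of_lt hx' ?_
    exact pow_lt_pow_right_of_lt_one₀ (by norm_num) (by norm_num) n.lt_succ_self
  refine ⟨?_, hγ, fun U => {x | |(s U).1 x| ≤ (1 / 2) ^ (n + 1)}, fun U hU =>
    ⟨isZeroSet_abs_le (s U).2 _, hsub U hU⟩, isGammaCover_image hγ.2.1 ?_ ?_⟩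
  · rintro _ ⟨f, -, rfl⟩
    exact isCozeroSet_abs_lt f.2 _
  · intro U hU h
    exact hγ.1.2 (univ_subset_iff.1 (h ▸ hsub U hU) ▸ hU)
  · intro x
    refine Set.Finite.of_finite_image (f := s) ((finite_setOf_le_abs hconv x
      (r := (1 / 2) ^ (n + 1)) (by positivity)).subset ?_) ?_
    · rintro _ ⟨U, ⟨hU, hx⟩, rfl⟩
      exact ⟨hsA U hU, (not_le.1 hx).le⟩
    · intro U hU V hV h
      rw [← hsU U hU.1, ← hsU V hV.1, h]

open Classical in
/-- In rounds where ONE's move has a uniformly small member, TWO takes that member. -/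
noncomputable def gammaFReduction (𝒱 : Set (Set X)) (h𝒱 : 𝒱 ∈ GammaF X) :
    GameReduction k (GammaF X) (Omega X) (GammaAt (Cp.zero X)) (OmegaAt (Cp.zero X)) where
  -- Here 𝒱 is only a legal dummy move; the reply to it is ignored.
  move n A := if HasSmallMember n A then 𝒱 else smallSet n '' A
  answer n A B :=
    if h : HasSmallMember n A then {h.choose} else Function.invFunOn (smallSet n) A '' B
  move_mem n A hA := by
    split_ifs with h
    · exact h𝒱
    · exact image_smallSet_mem_gammaF hA h
  answer_mem n A hA B hB := by
    split_ifs at hB ⊢ with h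
    · exact singleton_mem_legalMoves h.choose_spec.1
    · exact image_mem_legalMoves (fun U hU => Function.invFunOn_mem hU) hB
  wins A B hA hB hw := by
    refine zero_mem_closure_iff.2 fun F hF ε hε => ?_
    obtain ⟨N, hN⟩ := exists_pow_lt_of_lt_one hε (show (1 / 2 : ℝ) < 1 by norm_num)
    have hpow {n : ℕ} (hn : N ≤ n) : (1 / 2 : ℝ) ^ n < ε :=
      (pow_le_pow_of_le_one (by norm_num) (by norm_num) hn).trans_lt hN
    by_cases hs : ∃ n ≥ N, HasSmallMember n (A n)
    · obtain ⟨n, hn, h⟩ := hs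
      refine ⟨h.choose, mem_iUnion.2 ⟨n, by simp [h]⟩, fun x _ => ?_⟩
      have hx : x ∈ smallSet n h.choose := by rw [h.choose_spec.2]; trivial
      exact lt_trans hx (hpow hn)
    · push Not at hs
      -- Avoid the finitely many sets chosen before round N; the member found then comes from a
      -- genuine late round.
      obtain ⟨U, hU, hUn, hFU⟩ := hw.2.exists_notMem
        ((finite_lt_nat N).biUnion fun n _ => finite_of_mem_legalMoves (hB n)) hF
      obtain ⟨n, hn⟩ := mem_iUnion.1 hU
      have hNn : N ≤ n := by
        by_contra! hlt
        exact hUn (mem_biUnion (show n ∈ {i | i < N} from hlt) hn)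
      have hUA : U ∈ smallSet n '' A n := by
        simpa [hs n hNn] using subset_of_mem_legalMoves (hB n) hn
      refine ⟨_, mem_iUnion.2 ⟨n, by
        rw [dif_neg (hs n hNn)]; exact mem_image_of_mem _ hn⟩, fun x hx => ?_⟩
      have hx' := hFU hx
      rw [← Function.invFunOn_eq hUA] at hx'
      exact lt_trans hx' (hpow hNn)

/-- No dummy move exists here, but none is needed: every move of ONE has a uniformly small member in
every round. -/
theorem twoWinsMarkov_of_gammaF_eq_empty (h : GammaF X = ∅) :
    TwoWinsMarkov k (GammaAt (Cp.zero X)) (OmegaAt (Cp.zero X)) := by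
  have hsm : ∀ A n, A ∈ GammaAt (Cp.zero X) → HasSmallMember n A := by
    intro A n hA
    by_contra hn
    exact notMem_empty _ (h ▸ image_smallSet_mem_gammaF hA hn)
  choose! c hcA hc using hsm
  refine ⟨fun A n => {c A n}, fun A hA n => singleton_mem_legalMoves (hcA A n hA), ?_⟩
  refine fun A hA => zero_mem_closure_iff.2 fun F hF ε hε => ?_
  obtain ⟨N, hN⟩ := exists_pow_lt_of_lt_one hε (show (1 / 2 : ℝ) < 1 by norm_num)
  refine ⟨c (A N) N, mem_iUnion.2 ⟨N, rfl⟩, fun x _ => ?_⟩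
  have hx : x ∈ smallSet N (c (A N) N) := by rw [hc _ _ (hA N)]; trivial
  exact lt_trans hx hN

/-! ### Sequentially dense sets, and the way back to covers -/

theorem exists_subset_mem_gammaAt {S : Set (Cp X)} (hS : S ∈ SeqDenseSets (Cp X)) :
    ∃ A ∈ GammaAt (Cp.zero X), A ⊆ S := by
  by_cases h0 : Cp.zero X ∈ S
  · exact ⟨{Cp.zero X}, Or.inr rfl, singleton_subset_iff.2 h0⟩
  obtain ⟨u, huS, hu⟩ : Cp.zero X ∈ seqClosure S := by
    rw [show seqClosure S = univ from hS]; trivial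
  have hsub : range u ⊆ S := range_subset_iff.2 huS
  refine ⟨range u, Or.inl ⟨fun hfin => ?_, fun h => h0 (hsub h), fun U hU => ?_⟩, hsub⟩
  -- A finite range is closed, so it would contain the limit 0, which is not in S.
  · exact h0 (hsub (hfin.isClosed.mem_of_tendsto hu (.of_forall mem_range_self)))
  · obtain ⟨N, hN⟩ := eventually_atTop.1 (hu.eventually_mem hU)
    refine ((finite_lt_nat N).image u).subset ?_
    rintro _ ⟨⟨n, rfl⟩, hn⟩
    exact ⟨n, lt_of_not_ge fun h => hn (hN n h), rfl⟩

open Classical in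
/-- A sequentially dense set contains a set converging to `𝟎`. -/
noncomputable def gammaAtReduction :
    GameReduction k (GammaAt (Cp.zero X)) (OmegaAt (Cp.zero X))
      (SeqDenseSets (Cp X)) (OmegaAt (Cp.zero X)) where
  move _ S := if hS : S ∈ SeqDenseSets (Cp X) then (exists_subset_mem_gammaAt hS).choose else ∅
  answer _ _ B := B
  move_mem _ S hS := by
    rw [dif_pos hS]
    exact (exists_subset_mem_gammaAt hS).choose_spec.1
  answer_mem _ S hS B hB := by
    rw [dif_pos hS] at hB
    exact legalMoves_mono (exists_subset_mem_gammaAt hS).choose_spec.2 hB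
  wins _ _ _ _ h := h

/-- The continuous functions that are equal to `1` outside some member of `𝒰`. -/
def oneOffMember (𝒰 : Set (Set X)) : Set (Cp X) :=
  {f | ∃ U ∈ 𝒰, ∀ x ∉ U, f.1 x = 1}

theorem oneOffMember_mem_seqDenseSets {𝒰 : Set (Set X)} (h : 𝒰 ∈ GammaF X) :
    oneOffMember 𝒰 ∈ SeqDenseSets (Cp X) := by
  obtain ⟨hcoz, -, Z, hZ, -, hinf, hfin⟩ := h
  -- Distinct shrunken sets are enumerated, so that each point lies in all but finitely many of
  -- them.
  let z := hinf.natEmbedding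
  have hz (n : ℕ) : ∃ U ∈ 𝒰, Z U = z n := (z n).2
  choose U hU hUz using hz
  choose a ha ha0 ha1 using fun n =>
    exists_continuous_zero_one (hZ (U n) (hU n)).1 (hcoz _ (hU n)) (hZ (U n) (hU n)).2
  refine eq_univ_of_forall fun g => ?_
  -- This equals g on `Z (U n)` and 1 off `U n`, hence at each point it is eventually g.
  refine ⟨fun n => ⟨fun x => g.1 x * (1 - a n x) + a n x, ?_⟩, fun n => ?_, ?_⟩
  · exact (g.2.mul (continuous_const.sub (ha n))).add (ha n)
  · exact ⟨U n, hU n, fun x hx => by simp [ha1 n x hx]⟩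
  · refine Cp.tendsto_iff.2 fun x => tendsto_const_nhds.congr' ?_
    have hx : {n | x ∉ Z (U n)}.Finite := by
      refine Set.Finite.of_finite_image (f := fun n => Z (U n)) ((hfin x).subset ?_) ?_
      · rintro _ ⟨n, hn, rfl⟩
        exact ⟨mem_image_of_mem Z (hU n), hn⟩
      · intro m _ n _ hmn
        refine z.injective (Subtype.ext ?_)
        simpa [hUz] using hmn
    have hev : ∀ᶠ n in atTop, x ∈ Z (U n) := by
      rw [← Nat.cofinite_eq_atTop]
      exact hx
    filter_upwards [hev] with n hn
    simp [ha0 n x hn]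

open Classical in
/-- A cover from `Γ_F` is replaced by the set of continuous functions equal to `1` outside some
member of it. -/
noncomputable def seqDenseReduction :
    GameReduction k (SeqDenseSets (Cp X)) (OmegaAt (Cp.zero X)) (GammaF X) (Omega X) where
  move _ 𝒰 := oneOffMember 𝒰
  answer _ 𝒰 B := (fun f => if hf : f ∈ oneOffMember 𝒰 then hf.choose else ∅) '' B
  move_mem _ _ h := oneOffMember_mem_seqDenseSets h
  answer_mem _ 𝒰 _ B hB := by
    refine image_mem_legalMoves (fun f hf => ?_) hB
    rw [dif_pos hf]
    exact hf.choose_spec.1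
  wins 𝒰 B h𝒰 hB hw := by
    have hmem : ∀ U ∈ ⋃ n, (fun f => if hf : f ∈ oneOffMember (𝒰 n) then hf.choose else ∅) '' B n,
        ∃ n, U ∈ 𝒰 n := by
      intro U hU
      obtain ⟨n, f, hf, rfl⟩ := mem_iUnion.1 hU
      have hf' := subset_of_mem_legalMoves (hB n) hf
      refine ⟨n, ?_⟩
      simp only [dif_pos hf']
      exact hf'.choose_spec.1
    have hω : ∀ F : Set X, F.Finite → ∃ U ∈ ⋃ n, (fun f =>
        if hf : f ∈ oneOffMember (𝒰 n) then hf.choose else ∅) '' B n, F ⊆ U := by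
      intro F hF
      -- With ε = 1, no point of F can lie where f = 1, so F is inside the chosen member.
      obtain ⟨f, hf, hlt⟩ := zero_mem_closure_iff.1 hw F hF 1 one_pos
      obtain ⟨n, hn⟩ := mem_iUnion.1 hf
      have hf' := subset_of_mem_legalMoves (hB n) hn
      refine ⟨hf'.choose, mem_iUnion.2 ⟨n, f, hn, dif_pos hf'⟩, fun x hx => ?_⟩
      by_contra hxU
      have := hlt x hx
      rw [hf'.choose_spec.2 x hxU] at this
      simp at this
    refine ⟨fun U hU => ?_, ⟨eq_univ_of_forall fun x => ?_, fun hU => ?_⟩, hω⟩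
    · obtain ⟨n, hn⟩ := hmem U hU
      exact ((h𝒰 n).1 U hn).isOpen
    · obtain ⟨U, hU, hx⟩ := hω {x} (finite_singleton x)
      exact ⟨U, hU, hx rfl⟩
    · obtain ⟨n, hn⟩ := hmem _ hU
      exact (h𝒰 n).2.1.1.2 hn

/-- Translating by `g` carries the game at `𝟎` to the game at `g`. -/
def translateReduction (g : Cp X) :
    GameReduction k (SeqDenseSets (Cp X)) (OmegaAt (Cp.zero X))
      (SeqDenseSets (Cp X)) (OmegaAt g) where
  move _ S := Cp.translate g ⁻¹' S
  answer _ _ B := Cp.translate g '' B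
  move_mem _ _ hS := preimage_translate_mem_seqDenseSets g hS
  answer_mem _ S _ B hB := image_mem_legalMoves (mapsTo_preimage _ _) hB
  wins _ B _ _ hw := by
    have h := mem_closure_image (Cp.continuous_translate g).continuousAt hw
    rw [Cp.translate_zero, image_iUnion] at h
    exact h

theorem denseSets_of_denseSeq [SeparableSpace (Cp X)] :
    {C | ∀ j, ∃ B ∈ OmegaAt (denseSeq (Cp X) j), B ⊆ C} ⊆ DenseSets (Cp X) := by
  intro C hC
  have hsub : range (denseSeq (Cp X)) ⊆ closure C := by
    rintro _ ⟨j, rfl⟩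
    obtain ⟨B, hB, hBC⟩ := hC j
    exact closure_mono hBC hB
  exact dense_closure.1 ((denseRange_denseSeq (Cp X)).mono hsub)

theorem denseSets_subset_omegaAt (g : Cp X) : DenseSets (Cp X) ⊆ OmegaAt g :=
  fun _ hA => hA g

end Reductions

end CpGames

open CpGames TopologicalSpace in
theorem mainTheorem8 (X : Type*) [TopologicalSpace X] [T35Space X]
    (hX : CpGames.HasCoarserSecondCountable X) (k : CpGames.Kind) :
    List.TFAE
      [CpGames.TwoWins k (CpGames.GammaF X) (CpGames.Omega X),
       CpGames.TwoWins k (CpGames.GammaAt (CpGames.Cp.zero X)) (CpGames.OmegaAt (CpGames.Cp.zero X)),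
       CpGames.TwoWins k (CpGames.SeqDenseSets (CpGames.Cp X)) (CpGames.OmegaAt (CpGames.Cp.zero X)),
       CpGames.TwoWins k (CpGames.SeqDenseSets (CpGames.Cp X)) (CpGames.DenseSets (CpGames.Cp X))] ∧
    List.TFAE
      [CpGames.TwoWinsMarkov k (CpGames.GammaF X) (CpGames.Omega X),
       CpGames.TwoWinsMarkov k (CpGames.GammaAt (CpGames.Cp.zero X))
         (CpGames.OmegaAt (CpGames.Cp.zero X)),
       CpGames.TwoWinsMarkov k (CpGames.SeqDenseSets (CpGames.Cp X))
         (CpGames.OmegaAt (CpGames.Cp.zero X)),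
       CpGames.TwoWinsMarkov k (CpGames.SeqDenseSets (CpGames.Cp X))
         (CpGames.DenseSets (CpGames.Cp X))] := by
  have : SeparableSpace (Cp X) := separableSpace_cp hX
  constructor
  · tfae_have 1 → 2 := fun h => by
      rcases (GammaF X).eq_empty_or_nonempty with h0 | ⟨𝒱, h𝒱⟩
      · exact (twoWinsMarkov_of_gammaF_eq_empty h0).twoWins
      · exact (gammaFReduction 𝒱 h𝒱).twoWins h
    tfae_have 2 → 3 := gammaAtReduction.twoWins
    tfae_have 3 → 1 := seqDenseReduction.twoWins
    tfae_have 3 → 4 := fun h =>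
      (TwoWins.forall_nat fun j => (translateReduction (denseSeq (Cp X) j)).twoWins h).mono
        denseSets_of_denseSeq
    tfae_have 4 → 3 := TwoWins.mono (denseSets_subset_omegaAt _)
    tfae_finish
  · tfae_have 1 → 2 := fun h => by
      rcases (GammaF X).eq_empty_or_nonempty with h0 | ⟨𝒱, h𝒱⟩
      · exact twoWinsMarkov_of_gammaF_eq_empty h0
      · exact (gammaFReduction 𝒱 h𝒱).twoWinsMarkov h
    tfae_have 2 → 3 := gammaAtReduction.twoWinsMarkov
    tfae_have 3 → 1 := seqDenseReduction.twoWinsMarkov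
    tfae_have 3 → 4 := fun h =>
      (TwoWinsMarkov.forall_nat fun j =>
        (translateReduction (denseSeq (Cp X) j)).twoWinsMarkov h).mono denseSets_of_denseSeq
    tfae_have 4 → 3 := TwoWinsMarkov.mono (denseSets_subset_omegaAt _)
    tfae_finish
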